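/- For each integer $n \ge 0$ let $H_n(3)$ denote the number of $n \times n$ matrices with entries in $\{0,1\}$ all of whose row sums and column sums are equal to $3$. For a real sequence $\{a_n\}$ put $\mathscr{L} a_n = a_n a_{n+2} - a_{n+1}^2$ and $\mathscr{L}^k a_n = \mathscr{L}(\mathscr{L}^{k-1} a_n)$, and call the sequence $r$-log-convex if $\mathscr{L} a_n, \mathscr{L}^2 a_n, \ldots, \mathscr{L}^r a_n$ are all non-negative for every index $n$ of the sequence. **Theorem.** The sequence $\{H_n(3)\}_{n \ge 8}$ is $2$-log-convex; that is, $\mathscr{L} H_n(3) \ge 0$ and $\mathscr{L}^2 H_n(3) \ge 0$ for all $n \ge 8$. -/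

import Mathlib

/-- The operator `𝓛` on real sequences: `(𝓛 a) n = a n * a (n + 2) - a (n + 1) ^ 2`. -/
def logConvexOp (a : ℕ → ℝ) : ℕ → ℝ :=
  fun n => a n * a (n + 2) - a (n + 1) ^ 2

/-- A sequence `a` is `r`-log-convex if the sequences `𝓛 a, 𝓛² a, …, 𝓛ʳ a` are all
non-negative. -/
def IsLogConvexOfOrder (r : ℕ) (a : ℕ → ℝ) : Prop :=
  ∀ k : ℕ, 1 ≤ k → k ≤ r → ∀ n : ℕ, 0 ≤ (logConvexOp^[k] a) n

/-- `H_n(k)`: the number of `n × n` matrices with entries in `{0, 1}` (the type `Fin 2`, whose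
elements are read as natural numbers) all of whose row sums and column sums equal `k`. -/
def binaryMatrixCount (k n : ℕ) : ℕ :=
  Fintype.card {A : Matrix (Fin n) (Fin n) (Fin 2) //
    (∀ i, ∑ j, (A i j : ℕ) = k) ∧ (∀ j, ∑ i, (A i j : ℕ) = k)}

/-! Reading a matrix row by row, `H_n(3)` is the coefficient of `(x₁ ⋯ xₙ)³` in `e₃ⁿ`. Expand `6 e₃
= 2 p₃ - 3 p₂ p₁ + p₁³` by the multinomial theorem; the coefficient in each `p₃^α p₂^β p₁^(β + 3γ)`
is explicit (`psumCoeff_eq`). Hence `H_n(3) = n!² h_n` with `h_n` a signed triple sum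
(`binaryMatrixCount_three_eq`).

Inserting a shift `k` in the factorial (a factor `x^k` under `∫ x^j e^(-x) dx = j!`) yields
relations among the sums, and eliminating `k` gives a recurrence of order four for `h_n`
(`normalizedCount_recurrence`). By induction it confines `h_{k+1}/h_k` to a narrow band around
`3k/4` (`normalizedCount_ratio`). So `H_k H_{k+2} / H_{k+1}²` lies between `1 + 3/k` and `1 + 3/k +
9/k²`, which is tight enough for two-fold log-convexity (`logConvex_two_of_quotient`). -/

open Finset

/-! ### Triple sums and their shift relations -/

/-- The sum of `f α β γ` over all `(α, β, γ)` with `α + β + γ = n`. -/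
noncomputable def tripleSum (n : ℕ) (f : ℕ → ℕ → ℕ → ℝ) : ℝ :=
  ∑ p ∈ antidiagonal n, ∑ q ∈ antidiagonal p.2, f p.1 q.1 q.2

lemma tripleSum_congr {n : ℕ} {f g : ℕ → ℕ → ℕ → ℝ}
    (h : ∀ α β γ, α + β + γ = n → f α β γ = g α β γ) : tripleSum n f = tripleSum n g := by
  refine sum_congr rfl fun p hp => sum_congr rfl fun q hq => h _ _ _ ?_
  rw [HasAntidiagonal.mem_antidiagonal] at hp hq
  omega

lemma tripleSum_add (n : ℕ) (f g : ℕ → ℕ → ℕ → ℝ) :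
    tripleSum n (fun α β γ => f α β γ + g α β γ) = tripleSum n f + tripleSum n g := by
  simp only [tripleSum, sum_add_distrib]

lemma tripleSum_mul (n : ℕ) (a : ℝ) (f : ℕ → ℕ → ℕ → ℝ) :
    tripleSum n (fun α β γ => a * f α β γ) = a * tripleSum n f := by
  simp only [tripleSum, mul_sum]

lemma tripleSum_succ_fst {n : ℕ} {f : ℕ → ℕ → ℕ → ℝ} (h : ∀ β γ, f 0 β γ = 0) :
    tripleSum (n + 1) f = tripleSum n fun α β γ => f (α + 1) β γ := by
  simp only [tripleSum]
  rw [Nat.sum_antidiagonal_succ]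
  simp [h]

lemma tripleSum_succ_snd {n : ℕ} {f : ℕ → ℕ → ℕ → ℝ} (h : ∀ α γ, f α 0 γ = 0) :
    tripleSum (n + 1) f = tripleSum n fun α β γ => f α (β + 1) γ := by
  simp only [tripleSum]
  rw [Nat.sum_antidiagonal_succ']
  simp only [Nat.sum_antidiagonal_succ]
  simp [h]

lemma tripleSum_succ_trd {n : ℕ} {f : ℕ → ℕ → ℕ → ℝ} (h : ∀ α β, f α β 0 = 0) :
    tripleSum (n + 1) f = tripleSum n fun α β γ => f α β (γ + 1) := by
  simp only [tripleSum]
  rw [Nat.sum_antidiagonal_succ']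
  simp only [Nat.sum_antidiagonal_succ']
  simp [h]

/-- The summand of `momentSum`. -/
noncomputable def momentTerm (k α β γ : ℕ) : ℝ :=
  2 ^ α * (-3) ^ β * (β + 3 * γ + k).factorial /
    (α.factorial * β.factorial * γ.factorial ^ 2 * 6 ^ γ)

lemma momentTerm_succ_fst (k α β γ : ℕ) :
    ((α + 1 : ℕ) : ℝ) * momentTerm k (α + 1) β γ = 2 * momentTerm k α β γ := by
  simp only [momentTerm, Nat.factorial_succ α]
  push_cast
  have h : (α : ℝ) + 1 ≠ 0 := by positivity
  field_simp
  ring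

lemma momentTerm_succ_snd (k α β γ : ℕ) :
    ((β + 1 : ℕ) : ℝ) * momentTerm k α (β + 1) γ = -3 * momentTerm (k + 1) α β γ := by
  simp only [momentTerm, Nat.factorial_succ β]
  rw [show β + 1 + 3 * γ + k = β + 3 * γ + (k + 1) by ring]
  push_cast
  have h : (β : ℝ) + 1 ≠ 0 := by positivity
  field_simp
  ring

lemma momentTerm_succ_trd (k α β γ : ℕ) :
    6 * ((γ + 1 : ℕ) : ℝ) ^ 2 * momentTerm k α β (γ + 1) = momentTerm (k + 3) α β γ := by
  simp only [momentTerm, Nat.factorial_succ γ]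
  rw [show β + 3 * (γ + 1) + k = β + 3 * γ + (k + 3) by ring]
  push_cast
  have h : (γ : ℝ) + 1 ≠ 0 := by positivity
  field_simp
  ring

lemma momentTerm_succ (k α β γ : ℕ) :
    momentTerm (k + 1) α β γ = (β + 3 * γ + k + 1) * momentTerm k α β γ := by
  simp only [momentTerm, ← add_assoc, Nat.factorial_succ]
  push_cast
  ring

/-- The sum `∑ 2^α (-3)^β (β + 3γ + k)! / (α! β! γ!² 6^γ)` over `α + β + γ = n`. -/
noncomputable def momentSum (n k : ℕ) : ℝ := tripleSum n (momentTerm k)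

lemma tripleSum_fst_mul (n k : ℕ) :
    tripleSum (n + 1) (fun α β γ => α * momentTerm k α β γ) = 2 * momentSum n k := by
  rw [tripleSum_succ_fst (by simp), momentSum, ← tripleSum_mul]
  exact tripleSum_congr fun α β γ _ => momentTerm_succ_fst k α β γ

lemma tripleSum_snd_mul (n k : ℕ) :
    tripleSum (n + 1) (fun α β γ => β * momentTerm k α β γ) = -3 * momentSum n (k + 1) := by
  rw [tripleSum_succ_snd (by simp), momentSum, ← tripleSum_mul]
  exact tripleSum_congr fun α β γ _ => momentTerm_succ_snd k α β γ

lemma tripleSum_fst_mul_fst_mul (n k : ℕ) :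
    tripleSum (n + 2) (fun α β γ => α * (α * momentTerm k α β γ)) =
      4 * momentSum n k + 2 * momentSum (n + 1) k := by
  rw [tripleSum_succ_fst (by simp)]
  have : ∀ α β γ : ℕ, ((α + 1 : ℕ) : ℝ) * (((α + 1 : ℕ) : ℝ) * momentTerm k (α + 1) β γ) =
      2 * (α * momentTerm k α β γ) + 2 * momentTerm k α β γ := fun α β γ => by
    rw [momentTerm_succ_fst]; push_cast; ring
  simp only [this]
  rw [tripleSum_add, tripleSum_mul, tripleSum_mul, tripleSum_fst_mul, momentSum, momentSum]
  ring

lemma tripleSum_fst_mul_snd_mul (n k : ℕ) :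
    tripleSum (n + 2) (fun α β γ => α * (β * momentTerm k α β γ)) =
      -6 * momentSum n (k + 1) := by
  rw [tripleSum_succ_fst (by simp)]
  have : ∀ α β γ : ℕ, ((α + 1 : ℕ) : ℝ) * (β * momentTerm k (α + 1) β γ) =
      2 * (β * momentTerm k α β γ) := fun α β γ => by
    linear_combination (β : ℝ) * momentTerm_succ_fst k α β γ
  simp only [this]
  rw [tripleSum_mul, tripleSum_snd_mul]
  ring

lemma tripleSum_snd_mul_snd_mul (n k : ℕ) :
    tripleSum (n + 2) (fun α β γ => β * (β * momentTerm k α β γ)) =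
      9 * momentSum n (k + 2) - 3 * momentSum (n + 1) (k + 1) := by
  rw [tripleSum_succ_snd (by simp)]
  have : ∀ α β γ : ℕ, ((β + 1 : ℕ) : ℝ) * (((β + 1 : ℕ) : ℝ) * momentTerm k α (β + 1) γ) =
      -3 * (β * momentTerm (k + 1) α β γ) + -3 * momentTerm (k + 1) α β γ := fun α β γ => by
    rw [momentTerm_succ_snd]; push_cast; ring
  simp only [this]
  rw [tripleSum_add, tripleSum_mul, tripleSum_mul, tripleSum_snd_mul, momentSum, momentSum]
  ring

lemma tripleSum_trd_sq_mul (n k : ℕ) :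
    tripleSum (n + 1) (fun α β γ => 6 * (γ : ℝ) ^ 2 * momentTerm k α β γ) =
      momentSum n (k + 3) := by
  rw [tripleSum_succ_trd (by simp), momentSum]
  exact tripleSum_congr fun α β γ _ => momentTerm_succ_trd k α β γ

/-- On `α + β + γ = n + 1` the new factor `β + 3γ + k + 1` equals `3(n + 1) + k + 1 - 3α - 2β`, and
a factor `α` or `β` lowers `n` by one. -/
lemma momentSum_succ_right (n k : ℕ) :
    momentSum (n + 1) (k + 1) = (3 * (n + 1) + k + 1) * momentSum (n + 1) k -
      6 * momentSum n k + 6 * momentSum n (k + 1) := by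
  have h : momentSum (n + 1) (k + 1) = tripleSum (n + 1) (fun α β γ =>
      (3 * (n + 1) + k + 1 : ℝ) * momentTerm k α β γ + (-3 * (α * momentTerm k α β γ) +
        -2 * (β * momentTerm k α β γ))) := by
    refine tripleSum_congr fun α β γ hs => ?_
    have : (α : ℝ) + β + γ = n + 1 := mod_cast hs
    rw [momentTerm_succ]
    linear_combination (3 * momentTerm k α β γ) * this
  rw [h]
  simp only [tripleSum_add, tripleSum_mul, tripleSum_fst_mul, tripleSum_snd_mul]
  rw [← momentSum]
  ring

/-- A factor `6γ²` lowers `γ` and raises `k` by three; the relation comes from expanding it with `γ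
= n + 2 - α - β`. -/
lemma momentSum_add_three (n k : ℕ) :
    momentSum (n + 1) (k + 3) = 6 * (n + 2) ^ 2 * momentSum (n + 2) k -
      12 * (2 * n + 3) * momentSum (n + 1) k + 18 * (2 * n + 3) * momentSum (n + 1) (k + 1) +
      24 * momentSum n k - 72 * momentSum n (k + 1) + 54 * momentSum n (k + 2) := by
  have h : momentSum (n + 1) (k + 3) = tripleSum (n + 2) (fun α β γ =>
      (6 * (n + 2) ^ 2 : ℝ) * momentTerm k α β γ + ((-12 * (n + 2) : ℝ) * (α * momentTerm k α β γ) +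
        ((-12 * (n + 2) : ℝ) * (β * momentTerm k α β γ) + (6 * (α * (α * momentTerm k α β γ)) +
        (12 * (α * (β * momentTerm k α β γ)) + 6 * (β * (β * momentTerm k α β γ))))))) := by
    rw [← tripleSum_trd_sq_mul]
    refine tripleSum_congr fun α β γ hs => ?_
    have : (γ : ℝ) = n + 2 - α - β := by
      have : (α : ℝ) + β + γ = n + 2 := mod_cast hs
      linarith
    rw [this]
    ring
  rw [h]
  simp only [tripleSum_add, tripleSum_mul, tripleSum_fst_mul, tripleSum_snd_mul,
    tripleSum_fst_mul_fst_mul, tripleSum_fst_mul_snd_mul, tripleSum_snd_mul_snd_mul]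
  rw [← momentSum]
  ring

/-! ### The order-four recurrence -/

/-- The defect of the order-four recurrence for `n ↦ momentSum n 0`. -/
noncomputable def recurrenceDefect (m : ℕ) : ℝ :=
  12 * (m + 4) * (3 * m + 7) * momentSum (m + 4) 0 -
    54 * (m + 3) * (3 * m ^ 2 + 19 * m + 32) * momentSum (m + 3) 0 -
    108 * (3 * m + 13) * (m + 2) * momentSum (m + 2) 0 -
    216 * (9 * m ^ 2 + 42 * m + 37) * momentSum (m + 1) 0 +
    1296 * (3 * m + 10) * momentSum m 0

/-- Elimination of every sum with `k ≥ 1` from the shift relations. It makes consecutive defects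
proportional; as the left factor is positive, one vanishing defect forces the next to vanish. -/
lemma recurrenceDefect_succ (m : ℕ) :
    (81 / 2 * m ^ 5 + 1377 / 2 * m ^ 4 + 9189 / 2 * m ^ 3 + 15066 * m ^ 2 + 24308 * m + 30905 / 2) *
        recurrenceDefect (m + 1) =
      (81 * m ^ 4 + 1215 * m ^ 3 + 6705 * m ^ 2 + 16074 * m + 14035) * recurrenceDefect m := by
  have r30 := momentSum_succ_right (m + 3) 0
  have r31 := momentSum_succ_right (m + 3) 1
  have r32 := momentSum_succ_right (m + 3) 2
  have r20 := momentSum_succ_right (m + 2) 0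
  have r21 := momentSum_succ_right (m + 2) 1
  have r22 := momentSum_succ_right (m + 2) 2
  have r10 := momentSum_succ_right (m + 1) 0
  have r11 := momentSum_succ_right (m + 1) 1
  have r12 := momentSum_succ_right (m + 1) 2
  have r00 := momentSum_succ_right m 0
  have r01 := momentSum_succ_right m 1
  have s3 := momentSum_add_three (m + 3) 0
  have s2 := momentSum_add_three (m + 2) 0
  have s1 := momentSum_add_three (m + 1) 0
  have s0 := momentSum_add_three m 0
  push_cast [add_assoc] at r30 r31 r32 r20 r21 r22 r10 r11 r12 r00 r01 s3 s2 s1 s0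
  norm_num at r30 r31 r32 r20 r21 r22 r10 r11 r12 r00 r01 s3 s2 s1 s0
  simp only [recurrenceDefect, add_assoc]
  norm_num
  linear_combination (-((3 * m + 10) * (3 * m + 7)) : ℝ) * (
      (-243 * m ^ 5 - 3726 * m ^ 4 - 22113 * m ^ 3 - 63009 * m ^ 2 - 85065 * m - 42384) * r30 +
      (-81 * m ^ 4 - 1188 * m ^ 3 - 6417 * m ^ 2 - 15159 * m - 13245) * r31 +
      (-27 * m ^ 3 - 261 * m ^ 2 - 834 * m - 883) * r32 +
      (-6318 * m ^ 4 - 93798 * m ^ 3 - 515052 * m ^ 2 - 1240164 * m - 1104396) * r20 +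
      (486 * m ^ 4 + 9234 * m ^ 3 + 59994 * m ^ 2 + 163242 * m + 159414) * r21 +
      (324 * m ^ 3 + 3618 * m ^ 2 + 13140 * m + 15492) * r22 +
      (8748 * m ^ 4 + 133164 * m ^ 3 + 740016 * m ^ 2 + 1765584 * m + 1505916) * r10 +
      (-18468 * m ^ 3 - 207684 * m ^ 2 - 761292 * m - 908748) * r11 +
      (-972 * m ^ 3 - 12312 * m ^ 2 - 51732 * m - 72180) * r12 +
      (-17496 * m ^ 3 - 221616 * m ^ 2 - 931176 * m - 1299240) * r00 +
      (52488 * m ^ 3 + 664848 * m ^ 2 + 2793528 * m + 3897720) * r01 +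
      (27 * m ^ 3 + 261 * m ^ 2 + 834 * m + 883) * s3 +
      (-486 * m ^ 3 - 5184 * m ^ 2 - 18144 * m - 20790) * s2 +
      (2916 * m ^ 3 + 34020 * m ^ 2 + 130572 * m + 165132) * s1 +
      (-5832 * m ^ 3 - 73872 * m ^ 2 - 310392 * m - 433080) * s0)

lemma momentSum_zero_zero : momentSum 0 0 = 1 := by
  simp [momentSum, tripleSum, momentTerm]

lemma momentSum_one_zero : momentSum 1 0 = 0 := by
  simp [momentSum, tripleSum, momentTerm, Nat.sum_antidiagonal_eq_sum_range_succ_mk,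
    sum_range_succ, Nat.factorial]
  norm_num

lemma momentSum_two_zero : momentSum 2 0 = 0 := by
  simp [momentSum, tripleSum, momentTerm, Nat.sum_antidiagonal_eq_sum_range_succ_mk,
    sum_range_succ, Nat.factorial]
  norm_num

lemma momentSum_three_zero : momentSum 3 0 = 6 := by
  simp [momentSum, tripleSum, momentTerm, Nat.sum_antidiagonal_eq_sum_range_succ_mk,
    sum_range_succ, Nat.factorial]
  norm_num

lemma momentSum_four_zero : momentSum 4 0 = 54 := by
  simp [momentSum, tripleSum, momentTerm, Nat.sum_antidiagonal_eq_sum_range_succ_mk,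
    sum_range_succ, Nat.factorial]
  norm_num

lemma recurrenceDefect_eq_zero (m : ℕ) : recurrenceDefect m = 0 := by
  induction m with
  | zero =>
    simp only [recurrenceDefect, zero_add, momentSum_zero_zero, momentSum_one_zero,
      momentSum_two_zero, momentSum_three_zero, momentSum_four_zero]
    norm_num
  | succ m ih =>
    have h := recurrenceDefect_succ m
    rw [ih, mul_zero] at h
    exact (mul_eq_zero.mp h).resolve_left (by positivity)

/-- The number `momentSum n 0 / 6 ^ n`, which is `H_n(3) / n!²`. -/
noncomputable def normalizedCount (n : ℕ) : ℝ := momentSum n 0 / 6 ^ n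

lemma normalizedCount_recurrence (m : ℕ) :
    12 * (m + 4) * (3 * m + 7) * normalizedCount (m + 4) =
      9 * (m + 3) * (3 * m ^ 2 + 19 * m + 32) * normalizedCount (m + 3) +
      3 * (3 * m + 13) * (m + 2) * normalizedCount (m + 2) +
      (9 * m ^ 2 + 42 * m + 37) * normalizedCount (m + 1) -
      (3 * m + 10) * normalizedCount m := by
  have h := recurrenceDefect_eq_zero m
  simp only [recurrenceDefect] at h
  simp only [normalizedCount, pow_succ]
  field_simp
  linear_combination h

lemma normalizedCount_three : normalizedCount 3 = 1 / 36 := by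
  rw [normalizedCount, momentSum_three_zero]; norm_num

lemma normalizedCount_four : normalizedCount 4 = 1 / 24 := by
  rw [normalizedCount, momentSum_four_zero]; norm_num

lemma normalizedCount_five : normalizedCount 5 = 17 / 120 := by
  have h := normalizedCount_recurrence 1
  have h1 : normalizedCount 1 = 0 := by rw [normalizedCount, momentSum_one_zero, zero_div]
  have h2 : normalizedCount 2 = 0 := by rw [normalizedCount, momentSum_two_zero, zero_div]
  norm_num [normalizedCount_four, normalizedCount_three, h1, h2] at h
  linarith

lemma normalizedCount_six : normalizedCount 6 = 743 / 1296 := by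
  have h := normalizedCount_recurrence 2
  have h2 : normalizedCount 2 = 0 := by rw [normalizedCount, momentSum_two_zero, zero_div]
  norm_num [normalizedCount_five, normalizedCount_four, normalizedCount_three, h2] at h
  linarith

lemma normalizedCount_seven : normalizedCount 7 = 68938800 / 5040 ^ 2 := by
  have h := normalizedCount_recurrence 3
  norm_num [normalizedCount_six, normalizedCount_five, normalizedCount_four,
    normalizedCount_three] at h
  linarith

lemma normalizedCount_eight : normalizedCount 8 = 24046189440 / 40320 ^ 2 := by
  have h := normalizedCount_recurrence 4
  norm_num [normalizedCount_seven, normalizedCount_six, normalizedCount_five,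
    normalizedCount_four] at h
  linarith

lemma normalizedCount_nine : normalizedCount 9 = 12025780892160 / 362880 ^ 2 := by
  have h := normalizedCount_recurrence 5
  norm_num [normalizedCount_eight, normalizedCount_seven, normalizedCount_six,
    normalizedCount_five] at h
  linarith

/-! ### Two-sided bounds on consecutive ratios -/

/-- The ratio of consecutive terms `x`, `y` with indices `k`, `k + 1` is at least
`3k/4 + 4/(3(k+1))`. -/
def RatioLower (k x y : ℝ) : Prop := (9 * k * (k + 1) + 16) * x ≤ 12 * (k + 1) * y

/-- The ratio of consecutive terms `x`, `y` with indices `k`, `k + 1` is at most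
`3k/4 + 8/(5(k+1))`. -/
def RatioUpper (k x y : ℝ) : Prop := 20 * (k + 1) * y ≤ (15 * k * (k + 1) + 32) * x

lemma RatioLower.crude {k x y : ℝ} (hk : 0 ≤ k) (hx : 0 ≤ x) (h : RatioLower k x y) :
    3 * k * x ≤ 4 * y := by
  unfold RatioLower at h
  have h1 : 3 * (k + 1) * (3 * k * x) ≤ 3 * (k + 1) * (4 * y) := by linarith
  exact le_of_mul_le_mul_left h1 (by positivity)

lemma ratioLower_step {m a b c d e : ℝ} (hm : 0 ≤ m) (ha : 0 < a) (hd : 0 < d)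
    (hab : RatioLower (m + 6) a b) (hcd : RatioUpper (m + 8) c d)
    (h : 12 * (m + 10) * (3 * m + 25) * e =
      9 * (m + 9) * (3 * m ^ 2 + 55 * m + 254) * d + 3 * (3 * m + 31) * (m + 8) * c +
      (9 * m ^ 2 + 150 * m + 613) * b - (3 * m + 28) * a) :
    RatioLower (m + 9) d e := by
  have hb := hab.crude (by positivity) ha.le
  unfold RatioUpper at hcd
  unfold RatioLower
  -- The only negative term of the recurrence is absorbed by the `b` term, so both can be dropped.
  have hb' : (3 * m + 28) * a ≤ (9 * m ^ 2 + 150 * m + 613) * b := by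
    nlinarith [mul_pos ha (show 0 < m + 6 by linarith), mul_nonneg hm ha.le,
      mul_nonneg (show 0 ≤ 9 * m ^ 2 + 150 * m + 613 by positivity) (sub_nonneg.2 hb),
      mul_nonneg (mul_nonneg hm hm) ha.le, mul_nonneg (mul_nonneg (mul_nonneg hm hm) hm) ha.le]
  have hc : ((3 * m + 25) * (9 * (m + 9) * (m + 10) + 16) -
      9 * (m + 9) * (3 * m ^ 2 + 55 * m + 254)) * d ≤ 3 * (3 * m + 31) * (m + 8) * c := by
    have hD : 0 < 15 * (m + 8) * (m + 8 + 1) + 32 := by positivity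
    refine le_of_mul_le_mul_left ?_ hD
    have h1 := mul_le_mul_of_nonneg_left hcd (show 0 ≤ 3 * (3 * m + 31) * (m + 8) by positivity)
    -- The cubic terms in `m` cancel: `4/3` is the largest constant this step can carry. All
    -- remaining coefficients are positive.
    have h2 : 0 ≤ (3 * (3 * m + 31) * (m + 8) * (20 * (m + 9)) -
        (15 * (m + 8) * (m + 8 + 1) + 32) * ((3 * m + 25) * (9 * (m + 9) * (m + 10) + 16) -
      9 * (m + 9) * (3 * m ^ 2 + 55 * m + 254))) * d := by
      refine mul_nonneg ?_ hd.le
      ring_nf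
      positivity
    linarith
  have hE : (3 * m + 25) * ((9 * (m + 9) * (m + 9 + 1) + 16) * d) ≤
      (3 * m + 25) * (12 * (m + 9 + 1) * e) := by linarith
  exact le_of_mul_le_mul_left hE (by positivity)

/-- Here the negative `a` term is discarded, and `b` and `c` are bounded by multiples of `d` through
the crude ratio `3k/4`. -/
lemma ratioUpper_step {m a b c d e : ℝ} (hm : 0 ≤ m) (ha : 0 < a) (hb : 0 < b) (hc : 0 < c)
    (hd : 0 < d) (hbc : RatioLower (m + 7) b c) (hcd : RatioLower (m + 8) c d)
    (h : 12 * (m + 10) * (3 * m + 25) * e =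
      9 * (m + 9) * (3 * m ^ 2 + 55 * m + 254) * d + 3 * (3 * m + 31) * (m + 8) * c +
      (9 * m ^ 2 + 150 * m + 613) * b - (3 * m + 28) * a) :
    RatioUpper (m + 9) d e := by
  have hb := hbc.crude (by positivity) hb.le
  have hc := hcd.crude (by positivity) hc.le
  unfold RatioUpper
  have ha' : 0 ≤ (3 * m + 28) * a := by positivity
  have hbd : 9 * (m + 7) * (m + 8) * b ≤ 16 * d := by
    have := mul_le_mul_of_nonneg_left hb (show 0 ≤ 3 * (m + 8) by positivity)
    linarith
  have hE : (9 * (m + 7) * (m + 8) * 3 * (3 * m + 25)) * (20 * (m + 9 + 1) * e) ≤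
      (9 * (m + 7) * (m + 8) * 3 * (3 * m + 25)) * ((15 * (m + 9) * (m + 9 + 1) + 32) * d) := by
    have h1 := mul_le_mul_of_nonneg_left hc
      (show 0 ≤ 5 * 9 * (m + 7) * (3 * m + 31) * (m + 8) by positivity)
    have h2 := mul_le_mul_of_nonneg_left hbd
      (show 0 ≤ 5 * (9 * m ^ 2 + 150 * m + 613) by positivity)
    have h3 := mul_le_mul_of_nonneg_left ha'
      (show 0 ≤ 5 * 9 * (m + 7) * (m + 8) by positivity)
    have h4 : 0 ≤ (9 * (m + 7) * (m + 8) * 3 * (3 * m + 25) *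
        (15 * (m + 9) * (m + 9 + 1) + 32) -
        5 * 9 * (m + 7) * (m + 8) * (9 * (m + 9) * (3 * m ^ 2 + 55 * m + 254)) -
        5 * 9 * (m + 7) * (3 * m + 31) * (m + 8) * 4 -
        5 * (9 * m ^ 2 + 150 * m + 613) * 16) * d := by
      refine mul_nonneg ?_ hd.le
      ring_nf
      positivity
    linear_combination h1 + h2 + h3 + h4 + 5 * 9 * (m + 7) * (m + 8) * h
  exact le_of_mul_le_mul_left hE (by positivity)

/-- The window matches the four terms entering the recurrence: a new lower bound uses the previous
upper bound, a new upper bound uses only lower ones. The upper bound starts at index 8 because it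
narrowly fails at 7. -/
lemma normalizedCount_ratio (m : ℕ) :
    0 < normalizedCount (m + 6) ∧
    RatioLower (m + 6) (normalizedCount (m + 6)) (normalizedCount (m + 7)) ∧
    RatioLower (m + 7) (normalizedCount (m + 7)) (normalizedCount (m + 8)) ∧
    RatioLower (m + 8) (normalizedCount (m + 8)) (normalizedCount (m + 9)) ∧
    RatioUpper (m + 8) (normalizedCount (m + 8)) (normalizedCount (m + 9)) := by
  induction m with
  | zero =>
    norm_num [RatioLower, RatioUpper, normalizedCount_six, normalizedCount_seven,
      normalizedCount_eight, normalizedCount_nine]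
  | succ m ih =>
    obtain ⟨ha, hab, hbc, hcd, hcd'⟩ := ih
    have pos : ∀ {k x y : ℝ}, 0 < k → 0 < x → RatioLower k x y → 0 < y := fun hk hx h => by
      have h1 := h.crude hk.le hx.le
      have h2 := mul_pos (mul_pos (three_pos (α := ℝ)) hk) hx
      linarith
    have hb := pos (by positivity) ha hab
    have hc := pos (by positivity) hb hbc
    have hd := pos (by positivity) hc hcd
    have hm : (0 : ℝ) ≤ m := by positivity
    have h := normalizedCount_recurrence (m + 6)
    push_cast at h
    have h' : 12 * (m + 10 : ℝ) * (3 * m + 25) * normalizedCount (m + 10) =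
      9 * (m + 9) * (3 * m ^ 2 + 55 * m + 254) * normalizedCount (m + 9) +
      3 * (3 * m + 31) * (m + 8) * normalizedCount (m + 8) +
      (9 * m ^ 2 + 150 * m + 613) * normalizedCount (m + 7) -
      (3 * m + 28) * normalizedCount (m + 6) := by
      linear_combination h
    have hl := ratioLower_step hm ha hd hab hcd' h'
    have hu := ratioUpper_step hm ha hb hc hd hbc hcd h'
    have e : ∀ j : ℕ, m + 1 + j = m + (j + 1) := fun j => by ring
    have e' : ∀ j : ℝ, (m : ℝ) + 1 + j = m + (j + 1) := fun j => by ring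
    simp only [Nat.cast_add, Nat.cast_one, e, e']
    norm_num
    exact ⟨hb, hbc, hcd, hl, hu⟩

/-! ### From ratio bounds to log-convexity -/

lemma quotient_lower {n a b c : ℝ} (hn : 8 ≤ n) (hb : 0 < b)
    (hab : RatioUpper n a b) (hbc : RatioLower (n + 1) b c) :
    (n + 3) * (n + 1) ^ 2 * b ^ 2 ≤ n * (n + 2) ^ 2 * (a * c) := by
  -- After shifting by 8 the polynomial in `h2` has only nonnegative coefficients.
  obtain ⟨m, hm, rfl⟩ : ∃ m : ℝ, 0 ≤ m ∧ n = m + 8 := ⟨n - 8, by linarith, by ring⟩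
  unfold RatioLower at hbc
  unfold RatioUpper at hab
  have h1 := mul_le_mul hab hbc (by positivity) (le_trans (by positivity) hab)
  have h2 : 0 ≤ ((m + 8) * (m + 8 + 2) ^ 2 * (20 * (m + 8 + 1)) *
      (9 * (m + 8 + 1) * (m + 8 + 1 + 1) + 16) -
      (m + 8 + 3) * (m + 8 + 1) ^ 2 *
      ((15 * (m + 8) * (m + 8 + 1) + 32) * (12 * (m + 8 + 1 + 1)))) * b ^ 2 := by
    refine mul_nonneg ?_ (by positivity)
    ring_nf
    positivity
  have hD : 0 < (15 * (m + 8) * (m + 8 + 1) + 32) * (12 * (m + 8 + 1 + 1)) := by positivity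
  refine le_of_mul_le_mul_left ?_ hD
  have h3 := mul_le_mul_of_nonneg_left h1 (show 0 ≤ (m + 8) * (m + 8 + 2) ^ 2 by positivity)
  linarith

lemma quotient_upper {n a b c : ℝ} (hn : 8 ≤ n) (ha : 0 < a) (hb : 0 < b)
    (hab : RatioLower n a b) (hbc : RatioUpper (n + 1) b c) :
    n ^ 2 * (n + 2) ^ 2 * (a * c) ≤ (n ^ 2 + 3 * n + 9) * (n + 1) ^ 2 * b ^ 2 := by
  obtain ⟨m, hm, rfl⟩ : ∃ m : ℝ, 0 ≤ m ∧ n = m + 8 := ⟨n - 8, by linarith, by ring⟩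
  unfold RatioLower at hab
  unfold RatioUpper at hbc
  have h1 : (9 * (m + 8) * (m + 8 + 1) + 16) * a * (20 * (m + 8 + 1 + 1) * c) ≤
      12 * (m + 8 + 1) * b * ((15 * (m + 8 + 1) * (m + 8 + 1 + 1) + 32) * b) :=
    (mul_le_mul_of_nonneg_left hbc (by positivity)).trans
      (mul_le_mul_of_nonneg_right hab (by positivity))
  have h2 : 0 ≤ ((m + 8) ^ 2 + 3 * (m + 8) + 9) * (m + 8 + 1) ^ 2 *
      ((9 * (m + 8) * (m + 8 + 1) + 16) * (20 * (m + 8 + 1 + 1))) * b ^ 2 -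
      ((m + 8) ^ 2 * (m + 8 + 2) ^ 2 * (12 * (m + 8 + 1)) *
      (15 * (m + 8 + 1) * (m + 8 + 1 + 1) + 32)) * b ^ 2 := by
    rw [← sub_mul]
    refine mul_nonneg ?_ (by positivity)
    ring_nf
    positivity
  have hD : 0 < (9 * (m + 8) * (m + 8 + 1) + 16) * (20 * (m + 8 + 1 + 1)) := by positivity
  refine le_of_mul_le_mul_left ?_ hD
  have h3 := mul_le_mul_of_nonneg_left h1
    (show 0 ≤ (m + 8) ^ 2 * (m + 8 + 2) ^ 2 by positivity)
  linarith

/-- Five consecutive terms, from the index `n` on, of a positive sequence whose quotients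
`a_k a_{k+2} / a_{k+1}²` lie between `1 + 3/k` and `1 + 3/k + 9/k²`. -/
lemma logConvex_two_of_quotient {n a b c d e : ℝ} (hn : 0 < n) (hb : 0 < b) (hc : 0 < c)
    (hd : 0 < d) (h1 : (n + 3) * b ^ 2 ≤ n * (a * c))
    (h2 : (n + 4) * c ^ 2 ≤ (n + 1) * (b * d))
    (h2' : (n + 1) ^ 2 * (b * d) ≤ ((n + 1) ^ 2 + 3 * (n + 1) + 9) * c ^ 2)
    (h3 : (n + 5) * d ^ 2 ≤ (n + 2) * (c * e)) :
    (b * d - c ^ 2) ^ 2 ≤ (a * c - b ^ 2) * (c * e - d ^ 2) := by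
  have k1 : 3 * b ^ 2 ≤ n * (a * c - b ^ 2) := by linarith
  have k3 : 3 * d ^ 2 ≤ (n + 2) * (c * e - d ^ 2) := by linarith
  -- Since `3(n + 1) + 9 = 3(n + 4)`, the upper bound on `b d - c²` has the same factor `n + 4` as
  -- `h2`; what is left to compare is `n(n + 2) ≤ (n + 1)²`.
  have k2 : (n + 1) ^ 2 * (b * d - c ^ 2) ≤ 3 * (n + 4) * c ^ 2 := by linarith
  have k2' : 0 ≤ b * d - c ^ 2 := by
    have : 0 ≤ (n + 1) * (b * d - c ^ 2) := by
      have : 0 ≤ 3 * c ^ 2 := by positivity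
      linarith
    exact nonneg_of_mul_nonneg_right this (by linarith)
  have p := mul_le_mul k1 k3 (by positivity) (le_trans (by positivity) k1)
  have q := pow_le_pow_left₀ (by positivity) k2 2
  have r := pow_le_pow_left₀ (by positivity) h2 2
  have hD : 0 < (n + 1) ^ 4 := by positivity
  refine le_of_mul_le_mul_left ?_ hD
  have s : 0 ≤ (a * c - b ^ 2) * (c * e - d ^ 2) :=
    mul_nonneg (nonneg_of_mul_nonneg_right (le_trans (by positivity) k1) hn)
      (nonneg_of_mul_nonneg_right (le_trans (by positivity) k3) (by linarith : 0 < n + 2))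
  have t := mul_le_mul_of_nonneg_left p (show 0 ≤ (n + 1) ^ 2 by positivity)
  have u : n * (n + 2) * (n + 1) ^ 2 * ((a * c - b ^ 2) * (c * e - d ^ 2)) ≤
      (n + 1) ^ 4 * ((a * c - b ^ 2) * (c * e - d ^ 2)) := by
    refine mul_le_mul_of_nonneg_right ?_ s
    nlinarith [sq_nonneg (n + 1)]
  linarith

theorem isLogConvexOfOrder_two_of_eq {H : ℕ → ℝ}
    (hH : ∀ n, H n = (n.factorial : ℝ) ^ 2 * normalizedCount n) :
    IsLogConvexOfOrder 2 fun n => H (n + 8) := by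
  have pos (n : ℕ) : 0 < H (n + 8) := by
    rw [hH]
    exact mul_pos (by positivity) (normalizedCount_ratio (n + 2)).1
  have lower (n : ℕ) : ((n + 8 : ℝ) + 3) * H (n + 9) ^ 2 ≤ (n + 8) * (H (n + 8) * H (n + 10)) := by
    have hu := (normalizedCount_ratio n).2.2.2.2
    have hl := (normalizedCount_ratio (n + 1)).2.2.2.1
    have hb := (normalizedCount_ratio (n + 3)).1
    push_cast at hl
    rw [add_right_comm] at hl
    have := quotient_lower (by linarith [(n.cast_nonneg : (0 : ℝ) ≤ n)]) hb hu hl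
    simp only [hH, Nat.factorial_succ]
    push_cast
    have h := mul_le_mul_of_nonneg_left this
      (show 0 ≤ ((n + 8).factorial : ℝ) ^ 4 * (n + 9) ^ 2 by positivity)
    simp only [Nat.factorial_succ] at h
    push_cast at h
    linear_combination h
  have upper (n : ℕ) : (n + 8 : ℝ) ^ 2 * (H (n + 8) * H (n + 10)) ≤
      ((n + 8) ^ 2 + 3 * (n + 8) + 9) * H (n + 9) ^ 2 := by
    have hl := (normalizedCount_ratio n).2.2.2.1
    have hu := (normalizedCount_ratio (n + 1)).2.2.2.2
    have ha := (normalizedCount_ratio (n + 2)).1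
    have hb := (normalizedCount_ratio (n + 3)).1
    push_cast at hu
    rw [add_right_comm] at hu
    have := quotient_upper (by linarith [(n.cast_nonneg : (0 : ℝ) ≤ n)]) ha hb hl hu
    simp only [hH, Nat.factorial_succ]
    push_cast
    have h := mul_le_mul_of_nonneg_left this
      (show 0 ≤ ((n + 8).factorial : ℝ) ^ 4 * (n + 9) ^ 2 by positivity)
    simp only [Nat.factorial_succ] at h
    push_cast at h
    linear_combination h
  intro k h1 h2 n
  interval_cases k
  · simp only [Function.iterate_one, logConvexOp]
    have h := lower n
    have hp := pos (n + 1)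
    have hn : (0 : ℝ) < n + 8 := by positivity
    have e1 : n + 1 + 8 = n + 9 := rfl
    have e2 : n + 2 + 8 = n + 10 := rfl
    rw [e1] at hp ⊢
    rw [e2]
    have : 0 ≤ (n + 8 : ℝ) * (H (n + 8) * H (n + 10) - H (n + 9) ^ 2) := by
      have : 0 ≤ 3 * H (n + 9) ^ 2 := by positivity
      linarith
    exact nonneg_of_mul_nonneg_right this hn
  · simp only [Function.iterate_succ, Function.iterate_zero, Function.comp_apply, id, logConvexOp]
    refine sub_nonneg.2 ?_
    have h2 := lower (n + 1)
    have h2' := upper (n + 1)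
    have h3 := lower (n + 2)
    push_cast at h2 h2' h3
    refine logConvex_two_of_quotient (n := (n : ℝ) + 8) (by positivity) (pos (n + 1))
      (pos (n + 2)) (pos (n + 3)) (lower n) ?_ ?_ ?_
    · convert h2 using 2 <;> ring
    · convert h2' using 2 <;> ring
    · convert h3 using 2 <;> ring

/-! ### Counting matrices by symmetric functions -/

open MvPolynomial in
lemma esymm_eq_sum_binary_vector (n k : ℕ) :
    esymm (Fin n) ℝ k = ∑ v : Fin n → Fin 2 with ∑ j, (v j : ℕ) = k,
      monomial (Finsupp.equivFunOnFinite.symm fun j => (v j : ℕ)) 1 := by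
  rw [esymm_eq_sum_monomial]
  refine sum_nbij' (fun s j => if j ∈ s then 1 else 0) (fun v => ({j | v j = 1} : Finset (Fin n)))
    ?_ ?_ ?_ ?_ ?_
  · intro s hs
    rw [mem_powersetCard_univ] at hs
    simp [apply_ite, hs]
  · intro v hv
    simp only [mem_filter_univ] at hv
    rw [mem_powersetCard_univ, card_filter, ← hv]
    refine sum_congr rfl fun j _ => ?_
    generalize v j = x
    fin_cases x <;> rfl
  · intro s _
    ext j
    simp
  · intro v _
    ext j
    generalize hx : v j = x
    fin_cases x <;> simp [hx]
  · intro s _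
    congr 2
    ext j
    simp only [Finsupp.coe_finsetSum, Finset.sum_apply, Finsupp.single_apply,
      Finsupp.equivFunOnFinite_symm_apply_apply, sum_ite_eq']
    split_ifs <;> rfl

/-- The exponent `(3, …, 3)`. -/
noncomputable def constThree (n : ℕ) : Fin n →₀ ℕ := Finsupp.equivFunOnFinite.symm fun _ => 3

open MvPolynomial in
lemma binaryMatrixCount_three_eq_coeff (n : ℕ) :
    (binaryMatrixCount 3 n : ℝ) = coeff (constThree n) (esymm (Fin n) ℝ 3 ^ n) := by
  have h : esymm (Fin n) ℝ 3 ^ n = ∏ _i : Fin n, esymm (Fin n) ℝ 3 := by simp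
  rw [h, esymm_eq_sum_binary_vector, prod_univ_sum, coeff_sum]
  simp only [← monomial_sum_one, coeff_monomial]
  rw [← sum_filter, sum_const, nsmul_one, binaryMatrixCount]
  congr 1
  refine Fintype.card_of_subtype _ fun A => ?_
  refine mem_filter.trans
    (and_congr (Fintype.mem_piFinset.trans (forall_congr' fun i => mem_filter_univ _)) ?_)
  rw [DFunLike.ext_iff]
  simp [constThree, Finsupp.coe_finsetSum]

lemma Polynomial.coeff_X_pow_add_C_pow {R : Type*} [CommSemiring R] {d : ℕ} (hd : 0 < d) (c : R)
    (n k : ℕ) : ((X ^ d + C c) ^ n).coeff k =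
      if d ∣ k then c ^ (n - k / d) * (n.choose (k / d) : R) else 0 := by
  have h : (X ^ d + C c) ^ n = expand R d ((X + C c) ^ n) := by simp
  rw [h, coeff_expand hd, coeff_X_add_C_pow]

lemma Polynomial.coeff_three_mul {R : Type*} [CommSemiring R] (a b c : R) (α β k : ℕ) :
    ((X ^ 3 + C c) ^ α * ((X ^ 2 + C b) ^ β * (X ^ 1 + C a) ^ k)).coeff 3 =
      α • (c ^ (α - 1) * (b ^ β * a ^ k)) + (β * k) • (c ^ α * (b ^ (β - 1) * a ^ (k - 1))) +
        k.choose 3 • (c ^ α * (b ^ β * a ^ (k - 3))) := by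
  simp only [coeff_mul, Nat.sum_antidiagonal_eq_sum_range_succ_mk, sum_range_succ,
    Polynomial.coeff_X_pow_add_C_pow (Nat.succ_pos _), range_one, sum_singleton]
  norm_num
  ring

open MvPolynomial in
lemma finSuccEquiv_psum (n k : ℕ) :
    finSuccEquiv ℝ n (psum (Fin (n + 1)) ℝ k) =
      Polynomial.X ^ k + Polynomial.C (psum (Fin n) ℝ k) := by
  simp only [psum, Fin.sum_univ_succ, map_add, map_pow, map_sum, finSuccEquiv_X_zero,
    finSuccEquiv_X_succ]

lemma constThree_succ (n : ℕ) : constThree (n + 1) = (constThree n).cons 3 := by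
  ext i
  refine Fin.cases ?_ (fun j => ?_) i
  · rw [Finsupp.cons_zero]; rfl
  · rw [Finsupp.cons_succ]; rfl

/-- The coefficient of `(x₁ ⋯ xₙ)³` in a product of powers of the first three power sums. -/
noncomputable def psumCoeff (n α β k : ℕ) : ℝ :=
  MvPolynomial.coeff (constThree n) (MvPolynomial.psum (Fin n) ℝ 3 ^ α *
    (MvPolynomial.psum (Fin n) ℝ 2 ^ β * MvPolynomial.psum (Fin n) ℝ 1 ^ k))

open MvPolynomial in
-- The first variable gets its exponent 3 from one `p₃`, from one `p₂` and one `p₁`, or from three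
-- `p₁`. Truncated subtractions are harmless: their coefficients vanish.
lemma psumCoeff_succ (n α β k : ℕ) :
    psumCoeff (n + 1) α β k = α * psumCoeff n (α - 1) β k +
      (β * k) * psumCoeff n α (β - 1) (k - 1) + k.choose 3 * psumCoeff n α β (k - 3) := by
  simp only [psumCoeff]
  rw [constThree_succ, ← finSuccEquiv_coeff_coeff]
  simp only [map_mul, map_pow, finSuccEquiv_psum]
  rw [Polynomial.coeff_three_mul]
  simp only [coeff_add, coeff_smul]
  simp only [nsmul_eq_mul, Nat.cast_mul]

/-- Two factors among the `p₂` and `p₃` cannot share a variable, as its exponent would exceed 3. -/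
lemma psumCoeff_eq_zero (n : ℕ) : ∀ α β k : ℕ, n < α + β → psumCoeff n α β k = 0 := by
  induction n with
  | zero =>
    intro α β k h
    rcases α with _ | α
    · have : β ≠ 0 := by omega
      simp [psumCoeff, MvPolynomial.psum, this]
    · simp [psumCoeff, MvPolynomial.psum]
  | succ n ih =>
    intro α β k h
    rw [psumCoeff_succ, ih α (β - 1) _ (by omega), ih α β _ (by omega)]
    rcases α with _ | α
    · simp
    · rw [ih _ β k (by omega)]
      simp

/-- The three terms of `psumCoeff_succ` are `α`, `β` and `γ` times one common quantity, and `α + β +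
γ = n + 1`. -/
lemma psumCoeff_eq (n : ℕ) : ∀ α β γ : ℕ, α + β + γ = n → psumCoeff n α β (β + 3 * γ) =
    n.factorial * (β + 3 * γ).factorial / (γ.factorial * 6 ^ γ) := by
  induction n with
  | zero =>
    intro α β γ h
    obtain ⟨rfl, rfl, rfl⟩ : α = 0 ∧ β = 0 ∧ γ = 0 := by omega
    have : constThree 0 = 0 := Subsingleton.elim _ _
    simp [psumCoeff, this]
  | succ n ih =>
    intro α β γ h
    have h1 : α * psumCoeff n (α - 1) β (β + 3 * γ) =
        α * (n.factorial * (β + 3 * γ).factorial / (γ.factorial * 6 ^ γ)) := by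
      rcases α with _ | α
      · simp
      · rw [Nat.add_sub_cancel, ih α β γ (by omega)]
    have h2 : (β * (β + 3 * γ : ℕ)) * psumCoeff n α (β - 1) (β + 3 * γ - 1) =
        β * (n.factorial * (β + 3 * γ).factorial / (γ.factorial * 6 ^ γ)) := by
      rcases β with _ | β
      · simp
      · rw [show β + 1 + 3 * γ = β + 3 * γ + 1 by ring, Nat.add_sub_cancel, Nat.add_sub_cancel,
          ih α β γ (by omega), Nat.factorial_succ]
        push_cast
        ring
    have h3 : ((β + 3 * γ).choose 3 : ℝ) * psumCoeff n α β (β + 3 * γ - 3) =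
        γ * (n.factorial * (β + 3 * γ).factorial / (γ.factorial * 6 ^ γ)) := by
      rcases γ with _ | γ
      -- With `γ = 0` the binomial may survive, but then `α + β = n + 1 > n` kills the other factor.
      · rcases lt_or_ge β 3 with hβ | hβ
        · simp [Nat.choose_eq_zero_of_lt hβ]
        · rw [psumCoeff_eq_zero n α β _ (by omega)]
          simp
      · rw [show β + 3 * (γ + 1) = β + 3 * γ + 3 by ring, Nat.add_sub_cancel,
          ih α β γ (by omega)]
        have hc := Nat.add_choose_mul_factorial_mul_factorial (β + 3 * γ) 3
        have hc' : ((β + 3 * γ + 3).choose 3 : ℝ) * 6 * (β + 3 * γ).factorial =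
            (β + 3 * γ + 3).factorial := by
          rw [← hc]
          push_cast [Nat.factorial]
          ring
        rw [← hc', Nat.factorial_succ γ]
        push_cast
        field_simp
        ring
    rw [psumCoeff_succ, h1, h2, h3, Nat.factorial_succ n]
    have : (α : ℝ) + β + γ = n + 1 := mod_cast h
    push_cast
    rw [← this]
    ring

open MvPolynomial in
lemma six_mul_esymm_three (n : ℕ) :
    6 * esymm (Fin n) ℝ 3 = 2 * psum (Fin n) ℝ 3 + (-3 * (psum (Fin n) ℝ 2 * psum (Fin n) ℝ 1) +
      psum (Fin n) ℝ 1 ^ 3) := by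
  have h2 := mul_esymm_eq_sum (Fin n) ℝ 2
  have h3 := mul_esymm_eq_sum (Fin n) ℝ 3
  simp only [sum_filter, Nat.sum_antidiagonal_eq_sum_range_succ_mk, sum_range_succ] at h2 h3
  norm_num at h2 h3
  rw [psum_one]
  linear_combination 2 * h3 + (∑ i, X i) * h2

lemma choose_mul_choose_mul_eq {n α β γ : ℕ} (h : α + β + γ = n) :
    (n.choose α : ℝ) * (β + γ).choose β * (2 ^ α * (-3) ^ β) *
      (n.factorial * (β + 3 * γ).factorial / (γ.factorial * 6 ^ γ)) =
        (n.factorial : ℝ) ^ 2 * momentTerm 0 α β γ := by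
  subst h
  have h1 := Nat.add_choose_mul_factorial_mul_factorial α (β + γ)
  have h2 := Nat.add_choose_mul_factorial_mul_factorial β γ
  rw [← Nat.choose_symm_add, ← add_assoc] at h1
  rw [← Nat.choose_symm_add] at h2
  rw [momentTerm, add_zero]
  have h1' : ((α + β + γ).choose α : ℝ) * α.factorial * (β + γ).factorial =
      (α + β + γ).factorial := mod_cast h1
  have h2' : ((β + γ).choose β : ℝ) * β.factorial * γ.factorial = (β + γ).factorial :=
    mod_cast h2
  rw [← h1', ← h2']
  field_simp

open MvPolynomial in
lemma binaryMatrixCount_three_eq (n : ℕ) :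
    (binaryMatrixCount 3 n : ℝ) = (n.factorial : ℝ) ^ 2 * normalizedCount n := by
  rw [normalizedCount, momentSum, ← mul_div_assoc, eq_div_iff (by positivity), mul_comm,
    binaryMatrixCount_three_eq_coeff, ← coeff_C_mul, ← tripleSum_mul]
  have h : C (6 ^ n) * esymm (Fin n) ℝ 3 ^ n = (6 * esymm (Fin n) ℝ 3) ^ n := by
    rw [mul_pow, C_pow]; rfl
  have key (x y : MvPolynomial (Fin n) ℝ) (m : ℕ) := (Commute.all x y).add_pow' m
  simp only [h, six_mul_esymm_three, key, coeff_sum, tripleSum]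
  refine sum_congr rfl fun p hp => ?_
  rw [mul_sum, smul_sum, coeff_sum]
  refine sum_congr rfl fun q hq => ?_
  obtain ⟨α, s⟩ := p
  obtain ⟨β, γ⟩ := q
  rw [HasAntidiagonal.mem_antidiagonal] at hp hq
  dsimp only at hp hq ⊢
  subst hq
  rw [← add_assoc] at hp
  rw [← choose_mul_choose_mul_eq hp, ← psumCoeff_eq n α β γ hp, psumCoeff, ← coeff_C_mul]
  congr 1
  simp only [nsmul_eq_mul, map_mul, map_pow, map_natCast, map_neg, map_ofNat]
  ring

theorem mainTheorem5 :
    IsLogConvexOfOrder 2 (fun n : ℕ => (binaryMatrixCount 3 (n + 8) : ℝ)) :=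
  isLogConvexOfOrder_two_of_eq binaryMatrixCount_three_eq
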